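/- Let $\mathcal D,\mathcal T$ be monoidal categories and let $\mathbf t:\mathcal D\to\mathcal T$ be a strict monoidal functor (a monoidal refinement system; tensor products are written $\bullet$, and composition $c;d$ means "first $c$, then $d$"). An object $P$ of $\mathcal D$ refines $A\in\mathcal T$, written $P\sqsubset A$, if $\mathbf t(P)=A$; for $P\sqsubset A$, $c:A\to B$, $Q\sqsubset B$, a derivation of $(P,c,Q)$ is a morphism $\alpha:P\to Q$ with $\mathbf t(\alpha)=c$. A pushforward of $P\sqsubset A$ along $c:A\to B$ is a refinement $c_*P\sqsubset B$ with a derivation of $(P,c,c_*P)$ through which, for every $d:B\to C$ and $Q\sqsubset C$, each derivation of $(P,c;d,Q)$ factors uniquely by a derivation of $(c_*P,d,Q)$. For $B\in\mathcal T$ let $\mathbf t^+B$ be the category of pairs $(P\sqsubset A,\ c:A\to B)$, a morphism $(P_1,c_1)\to(P_2,c_2)$ being a morphism $\alpha:P_1\to P_2$ with $c_1=\mathbf t(\alpha);c_2$, and let $\mathbf t^-B=(\mathbf t^{\mathrm{op}})^+B$; the objects of $\mathbf t^-B$ are pairs $(d:B\to C,\ R\sqsubset C)$, and a morphism $(d_1,R_1)\to(d_2,R_2)$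 is a morphism $\gamma:R_2\to R_1$ with $d_1=d_2;\mathbf t(\gamma)$. The positive representation of $Q\sqsubset B$ is the presheaf $\mathbf t^+Q$ on $\mathbf t^+B$ sending $(P,c)$ to the set of derivations of $(P,c,Q)$, acting by precomposition. For presheaves $\phi$ on $\mathbf t^+B$ and $\psi$ on $\mathbf t^-B$ define the duals, as presheaves on $\mathbf t^-B$ and $\mathbf t^+B$ respectively, by the ends $$\phi^{\circ}(d,R)=\int_{(P,c)\in\mathbf t^+B}\mathrm{Hom}\bigl(\phi(P,c),\ \mathrm{Der}(P,c;d,R)\bigr),\qquad {}^{\circ}\psi(P,c)=\int_{(d,R)\in\mathbf t^-B}\mathrm{Hom}\bigl(\psi(d,R),\ \mathrm{Der}(P,c;d,R)\bigr),$$ where $\mathrm{Der}(P,e,R)$ is the set of derivations of $(P,e,R)$, acted on by composition on both sides. Let $W$ be a monoid in $\mathcal T$ with multiplication $p:W\bullet W\to W$, and let $P,Q\sqsubset W$ be such that the pushforward $P\otimes_W Q:=p_*(P\bullet Q)$ exists. Let $\mathbf t^+P\otimes_{\mathbf t^+W}\mathbf t^+Q$ be the Day tensor product, i.e. the left Kan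 extension of the presheaf $\bigl((P_1,c_1),(P_2,c_2)\bigr)\mapsto \mathbf t^+P(P_1,c_1)\times\mathbf t^+Q(P_2,c_2)$ along the functor $\mathbf t^+W\times\mathbf t^+W\to\mathbf t^+W$ sending $\bigl((P_1,c_1),(P_2,c_2)\bigr)$ to $\bigl(P_1\bullet P_2,\ (c_1\bullet c_2);p\bigr)$. Then there is a natural isomorphism of presheaves on $\mathbf t^+W$ $$\mathbf t^+(P\otimes_W Q)\;\cong\;{}^{\circ}\bigl((\mathbf t^+P\otimes_{\mathbf t^+W}\mathbf t^+Q)^{\circ}\bigr).$$ -/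

import Mathlib

open CategoryTheory MonoidalCategory Opposite

universe w w' v₁ v₂ v₃ u₁ u₂ u₃

namespace RefinementSystem

noncomputable section

/-! ### Presheaves over varying base categories

A presheaf over `C` is a functor `Cᵒᵖ ⥤ Type w`. Universe levels are kept general throughout, so
that no smallness assumption has to be made; (co)ends are formed in a large enough universe. -/

section Presheaves

variable {A : Type u₁} [Category.{v₁} A] {B : Type u₂} [Category.{v₂} B]
  {C : Type u₃} [Category.{v₃} C]

/-- The pullback `F* ψ = (a ↦ ψ (F a))` of a presheaf along a functor. -/
def pull (F : A ⥤ B) (ψ : Bᵒᵖ ⥤ Type w) : Aᵒᵖ ⥤ Type w := F.op ⋙ ψ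

/-- The relation generating the identifications in the coend `∃ a, B(b, F a) × φ(a)`. -/
inductive PushRel (F : A ⥤ B) (φ : Aᵒᵖ ⥤ Type w) (b : B) :
    (Σ a : A, (b ⟶ F.obj a) × φ.obj (op a)) → (Σ a : A, (b ⟶ F.obj a) × φ.obj (op a)) → Prop
  | glue {a a' : A} (f : a ⟶ a') (g : b ⟶ F.obj a) (x : φ.obj (op a')) :
      PushRel F φ b ⟨a, g, φ.map f.op x⟩ ⟨a', g ≫ F.map f, x⟩

/-- The pushforward `F_* φ = (b ↦ ∃ a, B(b, F a) × φ(a))` of a presheaf along a functor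
(a coend, acting by precomposition in `b`). -/
def push (F : A ⥤ B) (φ : Aᵒᵖ ⥤ Type w) : Bᵒᵖ ⥤ Type (max u₁ v₂ w) where
  obj b := Quot (PushRel F φ b.unop)
  map {b b'} h := TypeCat.ofHom
    (Quot.map (fun s => ⟨s.1, h.unop ≫ s.2.1, s.2.2⟩) (by
      rintro _ _ ⟨f, g, x⟩
      have := PushRel.glue (F := F) (φ := φ) f (h.unop ≫ g) x
      simpa using this))
  map_id b := by
    ext ⟨s⟩
    simp [Quot.map]
  map_comp f g := by
    ext ⟨s⟩
    simp [Quot.map]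

/-- The external tensor product `(a, b) ↦ φ(a) × ψ(b)` over the product category. -/
def extTensor (φ : Aᵒᵖ ⥤ Type w) (ψ : Bᵒᵖ ⥤ Type w') : (A × B)ᵒᵖ ⥤ Type (max w w') where
  obj x := φ.obj (op x.unop.1) × ψ.obj (op x.unop.2)
  map f := TypeCat.ofHom (fun s => (φ.map f.unop.1.op s.1, ψ.map f.unop.2.op s.2))
  map_id x := by
    ext s
    · simp
    · simp
  map_comp f g := by
    ext s
    · simp
    · simp

/-- The residual `F ↦ ∀ a, φ(a) → ω(F a)`, a presheaf over the functor category `A ⥤ C`. The end is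
the type of families natural in `a`. As the product of categories is symmetric, the left residual
`φ \ ω` and the right residual `ω / φ` are both given by this formula. -/
def residual (φ : Aᵒᵖ ⥤ Type w) (ω : Cᵒᵖ ⥤ Type w') : (A ⥤ C)ᵒᵖ ⥤ Type (max u₁ w w') where
  obj F := {θ : ∀ a : A, φ.obj (op a) → ω.obj (op (F.unop.obj a)) //
    ∀ ⦃a a' : A⦄ (f : a ⟶ a') (x : φ.obj (op a')),
      θ a (φ.map f.op x) = ω.map (F.unop.map f).op (θ a' x)}
  map {F G} τ := TypeCat.ofHom (fun θ =>
    ⟨fun a x => ω.map (τ.unop.app a).op (θ.1 a x), by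
      intro a a' f x
      simp only [θ.2 f x, ← Functor.map_comp_apply, ← op_comp, τ.unop.naturality f]⟩)
  map_id F := by
    ext θ a x
    simp
  map_comp σ τ := by
    ext θ a x
    simp

/-- The left currying `B ⥤ (A ⥤ C)` of a functor `p : A × B ⥤ C`. -/
def curryL (p : A × B ⥤ C) : B ⥤ A ⥤ C := Functor.curry.obj (CategoryTheory.Prod.swap B A ⋙ p)

/-- The right currying `A ⥤ (B ⥤ C)` of a functor `p : A × B ⥤ C`. -/
def curryR (p : A × B ⥤ C) : A ⥤ B ⥤ C := Functor.curry.obj p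

/-- Vertical isomorphism of presheaves over the same category, i.e. mutually inverse morphisms
lying over the identity functor: natural isomorphism, after lifting both presheaves to a
common universe. -/
def VIso (φ : Aᵒᵖ ⥤ Type w) (ψ : Aᵒᵖ ⥤ Type w') : Prop :=
  Nonempty (φ ⋙ uliftFunctor.{w', w} ≅ ψ ⋙ uliftFunctor.{w, w'})

end Presheaves

/-! ### Refinement systems

A refinement system is a functor `t : D ⥤ T`; the refinements of `A : T` are the elements of
`t.Fiber A`, and a derivation of the judgment `(P, c, Q)` is a morphism `α : P ⟶ Q` with
`t.IsHomLift c α`. -/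

section Basic

variable {D : Type u₁} [Category.{v₁} D] {T : Type u₂} [Category.{v₂} T] (t : D ⥤ T)

/-- A pushforward of a refinement `P` of `A` along `c : A ⟶ B`: a refinement of `B` with a
derivation of `(P, c, obj)` through which every derivation of `(P, c ≫ d, Q)` factors uniquely as a
derivation of `(obj, d, Q)`. -/
structure Pushforward {A B : T} (c : A ⟶ B) (P : t.Fiber A) where
  obj : t.Fiber B
  hom : P.1 ⟶ obj.1
  universal : t.IsStronglyCocartesian c hom

/-- The relative slice `t⁺B`: objects are pairs `(P, c : t P ⟶ B)`, morphisms
`(P₁, c₁) ⟶ (P₂, c₂)` are `α : P₁ ⟶ P₂` with `t α ≫ c₂ = c₁`. -/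
abbrev PosCat (B : T) := CostructuredArrow t B

/-- The functor `t⁺A ⥤ t⁺B` sending `(P, d)` to `(P, d ≫ c)`. -/
abbrev posMap {A B : T} (c : A ⟶ B) : PosCat t A ⥤ PosCat t B := CostructuredArrow.map c

/-- The positive representation of a refinement `Q` of `B`: the presheaf over `t⁺B` sending
`(P, c)` to the set of derivations of `(P, c, Q)`, acting by precomposition. -/
def pos {B : T} (Q : t.Fiber B) : (PosCat t B)ᵒᵖ ⥤ Type v₁ where
  obj x := {α : x.unop.left ⟶ Q.1 // t.IsHomLift x.unop.hom α}
  map {x y} f := TypeCat.ofHom (fun α => ⟨f.unop.left ≫ α.1, by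
    have := α.2
    rw [← CostructuredArrow.w f.unop]
    infer_instance⟩)
  map_id x := by
    ext α
    simp
  map_comp f g := by
    ext α
    simp

/-- The category `t⁻A`: the relative slice of the opposite refinement system. Its objects amount to
pairs `(c : A ⟶ t Q, Q)`, and it is the opposite of the relative coslice. -/
abbrev NegCat (A : T) := PosCat t.op (op A)

/-- Typing judgments `(P, c, Q)` with `c : t P ⟶ t Q`. -/
structure Judgment where
  src : D
  tgt : D
  term : t.obj src ⟶ t.obj tgt

variable {t} in
/-- A morphism `(P₁, c₁, Q₁) ⟶ (P₂, c₂, Q₂)` is a pair `β : P₁ ⟶ P₂`, `γ : Q₂ ⟶ Q₁` with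
`c₁ = t β ≫ c₂ ≫ t γ`. -/
@[ext]
structure Judgment.Hom (J K : Judgment t) where
  fst : J.src ⟶ K.src
  snd : K.tgt ⟶ J.tgt
  w : J.term = t.map fst ≫ K.term ≫ t.map snd

/-- The category of judgments. -/
instance : Category (Judgment t) where
  Hom := Judgment.Hom
  id J := ⟨𝟙 _, 𝟙 _, by simp⟩
  comp f g := ⟨f.fst ≫ g.fst, g.snd ≫ f.snd, by rw [f.w, g.w]; simp⟩
  id_comp f := by apply Judgment.Hom.ext <;> simp
  comp_id f := by apply Judgment.Hom.ext <;> simp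
  assoc f g h := by apply Judgment.Hom.ext <;> simp

/-- The presheaf of derivations over the category of judgments. -/
def der : (Judgment t)ᵒᵖ ⥤ Type v₁ where
  obj J := {α : J.unop.src ⟶ J.unop.tgt // t.map α = J.unop.term}
  map {J K} f := TypeCat.ofHom (fun α => ⟨f.unop.fst ≫ α.1 ≫ f.unop.snd, by
    simp [α.2, f.unop.w]⟩)
  map_id J := by
    ext α
    change 𝟙 _ ≫ α.1 ≫ 𝟙 _ = α.1
    simp
  map_comp {J K L} f g := by
    ext α
    change (g.unop.fst ≫ f.unop.fst) ≫ α.1 ≫ (f.unop.snd ≫ g.unop.snd) =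
      g.unop.fst ≫ (f.unop.fst ≫ α.1 ≫ f.unop.snd) ≫ g.unop.snd
    simp

/-- The bracket functor `((P, c), (d, R)) ↦ (P, c ≫ d, R)`. -/
def bracket (B : T) : PosCat t B × NegCat t B ⥤ Judgment t where
  obj x := ⟨x.1.left, x.2.left.unop, x.1.hom ≫ x.2.hom.unop⟩
  map {x y} f := ⟨f.1.left, f.2.left.unop, by
    have h₁ : t.map f.1.left ≫ y.1.hom = x.1.hom := CostructuredArrow.w f.1
    have h₂ : y.2.hom.unop ≫ t.map f.2.left.unop = x.2.hom.unop :=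
      congrArg Quiver.Hom.unop (CostructuredArrow.w f.2)
    rw [← h₁, ← h₂]
    simp⟩
  map_id x := rfl
  map_comp f g := rfl

/-- The dual of a presheaf over `t⁺B`: the pullback, along the left currying of the bracket, of
the left residual of the presheaf of derivations by `φ`. -/
def dualL {B : T} (φ : (PosCat t B)ᵒᵖ ⥤ Type w) : (NegCat t B)ᵒᵖ ⥤ Type (max u₁ v₁ v₂ w) :=
  pull (curryL (bracket t B)) (residual φ (der t))

/-- The dual of a presheaf over `t⁻B`: the pullback, along the right currying of the bracket, of
the right residual of the presheaf of derivations by `ψ`. -/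
def dualR {B : T} (ψ : (NegCat t B)ᵒᵖ ⥤ Type w) : (PosCat t B)ᵒᵖ ⥤ Type (max u₁ v₁ v₂ w) :=
  pull (curryR (bracket t B)) (residual ψ (der t))

end Basic

/-! ### Monoidal refinement systems -/

section Monoidal

open Functor.LaxMonoidal Functor.OplaxMonoidal

variable {D : Type u₁} [Category.{v₁} D] {T : Type u₂} [Category.{v₂} T]
  [MonoidalCategory D] [MonoidalCategory T]

/-- A monoidal refinement system: `t` is a strict monoidal functor, i.e. a monoidal functor whose
structure maps are identities. -/
class StrictMonoidal (t : D ⥤ T) extends t.Monoidal where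
  obj_tensor : ∀ P Q : D, t.obj P ⊗ t.obj Q = t.obj (P ⊗ Q)
  obj_unit : 𝟙_ T = t.obj (𝟙_ D)
  μ_eq : ∀ P Q : D, μ P Q = eqToHom (obj_tensor P Q)
  ε_eq : ε = eqToHom obj_unit

variable (t : D ⥤ T) [StrictMonoidal t]

/-- The tensor product of a refinement of `A` and a refinement of `B`, a refinement of `A ⊗ B`. -/
def tensorRef {A B : T} (P : t.Fiber A) (Q : t.Fiber B) : t.Fiber (A ⊗ B) :=
  ⟨P.1 ⊗ Q.1, by rw [← StrictMonoidal.obj_tensor, P.2, Q.2]⟩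

/-- A fiberwise tensor product `P ⊗_W Q` of two refinements of a monoid `W`: a pushforward of
`P ⊗ Q` along the multiplication `W ⊗ W ⟶ W`. -/
abbrev FiberTensor (W : T) [MonObj W] (P Q : t.Fiber W) :=
  Pushforward t (MonObj.mul (X := W)) (tensorRef t P Q)

/-- The functor `t⁺A × t⁺B ⥤ t⁺(A ⊗ B)` sending `((P₁, c₁), (P₂, c₂))` to `(P₁ ⊗ P₂, c₁ ⊗ c₂)`;
here `δ` is the identity of `t (P₁ ⊗ P₂) = t P₁ ⊗ t P₂`. -/
def str (A B : T) : PosCat t A × PosCat t B ⥤ PosCat t (A ⊗ B) where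
  obj x := CostructuredArrow.mk (δ t x.1.left x.2.left ≫ (x.1.hom ⊗ₘ x.2.hom))
  map {x y} f := CostructuredArrow.homMk (f.1.left ⊗ₘ f.2.left) (by
    have h₁ : t.map f.1.left ≫ y.1.hom = x.1.hom := CostructuredArrow.w f.1
    have h₂ : t.map f.2.left ≫ y.2.hom = x.2.hom := CostructuredArrow.w f.2
    rw [← h₁, ← h₂, ← MonoidalCategory.tensorHom_comp_tensorHom]
    exact (δ_natural_assoc t f.1.left f.2.left _).symm)
  map_id x := by
    ext
    simp
  map_comp f g := by
    ext
    simp [MonoidalCategory.tensorHom_comp_tensorHom]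

/-- The Day tensor product of presheaves over `t⁺W` for a monoid `W`: the pushforward of the
external tensor product along the tensor product functor `t⁺W × t⁺W ⥤ t⁺(W ⊗ W) ⥤ t⁺W`. -/
def dayTensor (W : T) [MonObj W] (φ : (PosCat t W)ᵒᵖ ⥤ Type w) (ψ : (PosCat t W)ᵒᵖ ⥤ Type w') :
    (PosCat t W)ᵒᵖ ⥤ Type (max u₁ v₁ v₂ w w') :=
  push (str t W W ⋙ posMap t (MonObj.mul (X := W))) (extTensor φ ψ)

end Monoidal

end

end RefinementSystem

namespace RefinementSystem

noncomputable section

/-! ### Representable presheaves -/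

section Presheaves

variable {A : Type u₁} [Category.{v₁} A] {B : Type u₂} [Category.{v₂} B]
  {C : Type u₃} [Category.{v₃} C]

/-! Every presheaf in the statement is representable, so each coend and end collapses by Yoneda.
`pos t P` is represented by `(P, 𝟙)`. Left Kan extension preserves representability, so the Day
tensor product is represented by `(P ⊗ Q, p)`, with `p` the multiplication of `W`
(`dayTensorRepresentableBy`). By `residualEquiv`, the dual of a presheaf represented by `(Z, c)` is
`(d, S) ↦ Der(Z, c ≫ d, S)`. The universal property of a pushforward `R` of `Z` along `c` says
exactly that this is represented by `(𝟙, R)` in `t⁻B` (`dualLRepresentableBy`); the existence of `P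
⊗_W Q` is used only here. Yoneda once more turns the second dual into `(X, e) ↦ Der(X, e, R)`, which
is `pos t R` (`viso_pos_dualR`). -/

/-- The external tensor product of representable presheaves is representable. -/
def extTensorRepresentableBy {φ : Aᵒᵖ ⥤ Type w} {ψ : Bᵒᵖ ⥤ Type w'} {a : A} {b : B}
    (h : φ.RepresentableBy a) (k : ψ.RepresentableBy b) :
    (extTensor φ ψ).RepresentableBy (a, b) where
  homEquiv :=
    { toFun := fun f => (h.homEquiv f.1, k.homEquiv f.2)
      invFun := fun s => (h.homEquiv.symm s.1, k.homEquiv.symm s.2)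
      left_inv := fun f => Prod.ext (h.homEquiv.symm_apply_apply f.1)
        (k.homEquiv.symm_apply_apply f.2)
      right_inv := fun s => Prod.ext (h.homEquiv.apply_symm_apply s.1)
        (k.homEquiv.apply_symm_apply s.2) }
  homEquiv_comp f g := Prod.ext (h.homEquiv_comp f.1 g.1) (k.homEquiv_comp f.2 g.2)

/-- The pushforward along `F` of a presheaf represented by `a` is represented by `F a`. -/
def pushRepresentableBy (F : A ⥤ B) {φ : Aᵒᵖ ⥤ Type w} {a : A} (h : φ.RepresentableBy a) :
    (push F φ).RepresentableBy (F.obj a) where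
  homEquiv {b} :=
    { toFun := fun g => Quot.mk _ ⟨a, g, h.homEquiv (𝟙 a)⟩
      invFun := Quot.lift (fun s => s.2.1 ≫ F.map (h.homEquiv.symm s.2.2)) (by
        rintro _ _ ⟨f, g, x⟩
        simp [← h.comp_homEquiv_symm])
      left_inv := fun g => by simp
      right_inv := by
        rintro ⟨a', g, x⟩
        -- Gluing along the morphism `a' ⟶ a` that classifies `x` moves any element of the coend to
        -- one carrying the universal element.
        have := Quot.sound (PushRel.glue (F := F) (φ := φ) (h.homEquiv.symm x) g (h.homEquiv (𝟙 a)))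
        rw [← h.homEquiv_eq, Equiv.apply_symm_apply] at this
        exact this.symm }
  homEquiv_comp _ _ := rfl

/-- If `φ` is represented by `a`, its residual `F ↦ ∀ x, φ(x) → ω(F x)` is `F ↦ ω(F a)`. -/
def residualEquiv {φ : Aᵒᵖ ⥤ Type w} {a : A} (h : φ.RepresentableBy a) (ω : Cᵒᵖ ⥤ Type w')
    (F : A ⥤ C) : (residual φ ω).obj (op F) ≃ ω.obj (op (F.obj a)) where
  toFun θ := θ.1 a (h.homEquiv (𝟙 a))
  invFun y := ⟨fun _ x => ω.map (F.map (h.homEquiv.symm x)).op y, by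
    intro b b' f x
    change ω.map (F.map (h.homEquiv.symm (φ.map f.op x))).op y =
      ω.map (F.map f).op (ω.map (F.map (h.homEquiv.symm x)).op y)
    rw [← h.comp_homEquiv_symm, F.map_comp, op_comp, Functor.map_comp_apply]⟩
  left_inv θ := by
    apply Subtype.ext
    funext b x
    change ω.map (F.map (h.homEquiv.symm x)).op (θ.1 a (h.homEquiv (𝟙 a))) = θ.1 b x
    -- Naturality of `θ` along the morphism classifying `x` determines it from its value at the
    -- universal element.
    refine (θ.2 (h.homEquiv.symm x) (h.homEquiv (𝟙 a))).symm.trans ?_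
    rw [← h.homEquiv_eq, Equiv.apply_symm_apply]
  right_inv y := by simp

lemma residualEquiv_map {φ : Aᵒᵖ ⥤ Type w} {a : A} (h : φ.RepresentableBy a)
    (ω : Cᵒᵖ ⥤ Type w') {F G : A ⥤ C} (τ : G ⟶ F) (θ : (residual φ ω).obj (op F)) :
    residualEquiv h ω G ((residual φ ω).map τ.op θ) =
      ω.map (τ.app a).op (residualEquiv h ω F θ) := rfl

/-- A natural family of bijections is a vertical isomorphism. -/
lemma VIso.of_equiv {φ : Aᵒᵖ ⥤ Type w} {ψ : Aᵒᵖ ⥤ Type w'}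
    (e : ∀ a : A, φ.obj (op a) ≃ ψ.obj (op a))
    (he : ∀ ⦃a a' : A⦄ (f : a ⟶ a') (x : φ.obj (op a')),
      e a (φ.map f.op x) = ψ.map f.op (e a' x)) : VIso φ ψ :=
  ⟨NatIso.ofComponents
    (fun a => (Equiv.ulift.trans ((e a.unop).trans Equiv.ulift.symm)).toIso) (by
      intro a a' f
      ext x
      exact congrArg ULift.up (he f.unop x.down))⟩

end Presheaves

/-! ### Representability and duality in a refinement system -/

section Basic

variable {D : Type u₁} [Category.{v₁} D] {T : Type u₂} [Category.{v₂} T] (t : D ⥤ T)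

/-- A refinement `Q` of `B` as the object `(Q, 𝟙)` of `t⁺B`. -/
def posObj {B : T} (Q : t.Fiber B) : PosCat t B := CostructuredArrow.mk (Y := Q.1) (eqToHom Q.2)

/-- A refinement `Q` of `B` as the object `(𝟙, Q)` of `t⁻B`. -/
def negObj {B : T} (Q : t.Fiber B) : NegCat t B :=
  CostructuredArrow.mk (S := t.op) (Y := op Q.1) (eqToHom Q.2.symm).op

/-- Turns the lifting condition into the commuting triangle that defines morphisms into `(Q, 𝟙)` in
`t⁺B`; the next lemma does the same for `t⁻B`. The `eqToHom` absorbs the propositional equality `t Q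
= B`. -/
lemma isHomLift_iff_comp_eqToHom {B : T} (Q : t.Fiber B) {X : D} (c : t.obj X ⟶ B)
    (α : X ⟶ Q.1) : t.IsHomLift c α ↔ t.map α ≫ eqToHom Q.2 = c := by
  obtain ⟨Q, rfl⟩ := Q
  refine ⟨fun _ => ?_, ?_⟩
  · simpa using (IsHomLift.eq_of_isHomLift t c α).symm
  · rintro rfl
    simp

lemma isHomLift_iff_eqToHom_comp {B : T} (Q : t.Fiber B) {X : D} (d : B ⟶ t.obj X)
    (γ : Q.1 ⟶ X) : t.IsHomLift d γ ↔ eqToHom Q.2.symm ≫ t.map γ = d := by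
  obtain ⟨Q, rfl⟩ := Q
  refine ⟨fun _ => ?_, ?_⟩
  · simpa using (IsHomLift.eq_of_isHomLift t d γ).symm
  · rintro rfl
    simp

/-- The positive representation of `Q` is represented by `(Q, 𝟙)`. -/
def posRepresentableBy {B : T} (Q : t.Fiber B) : (pos t Q).RepresentableBy (posObj t Q) where
  homEquiv :=
    { toFun := fun f => ⟨f.left, (isHomLift_iff_comp_eqToHom t Q _ _).2 (CostructuredArrow.w f)⟩
      invFun := fun α => CostructuredArrow.homMk α.1 ((isHomLift_iff_comp_eqToHom t Q _ _).1 α.2)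
      left_inv := fun _ => rfl
      right_inv := fun _ => rfl }
  homEquiv_comp _ _ := rfl

lemma isStronglyCocartesian_eqToHom_comp {A A' B : T} (e : A' = A) (c : A ⟶ B) {X Y : D}
    (k : X ⟶ Y) [t.IsStronglyCocartesian c k] : t.IsStronglyCocartesian (eqToHom e ≫ c) k := by
  subst e
  simpa

/-- The morphism `R ⟶ S` underlying a morphism `(d, S) ⟶ (𝟙, R)` of `t⁻B`. -/
def negObjHom {B : T} {R : t.Fiber B} {N : NegCat t B} (f : N ⟶ negObj t R) :
    R.1 ⟶ N.left.unop := f.left.unop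

instance isHomLift_negObjHom {B : T} {R : t.Fiber B} {N : NegCat t B} (f : N ⟶ negObj t R) :
    t.IsHomLift N.hom.unop (negObjHom t f) :=
  (isHomLift_iff_eqToHom_comp t R _ _).2 (congrArg Quiver.Hom.unop (CostructuredArrow.w f))

/-- If `R` is a pushforward of `Z` along `c`, morphisms `(d, S) ⟶ (𝟙, R)` in `t⁻B` correspond to
derivations of `(Z, c ≫ d, S)`. -/
def negObjHomEquiv {B : T} {Z : PosCat t B} (R : t.Fiber B) (k : Z.left ⟶ R.1)
    [hk : t.IsStronglyCocartesian Z.hom k] (N : NegCat t B) :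
    (N ⟶ negObj t R) ≃ {α : Z.left ⟶ N.left.unop // t.map α = Z.hom ≫ N.hom.unop} :=
  Equiv.ofBijective
    (fun f => ⟨k ≫ negObjHom t f,
      (IsHomLift.eq_of_isHomLift t (Z.hom ≫ N.hom.unop) (k ≫ negObjHom t f)).symm⟩) (by
    constructor
    · intro f g hfg
      apply CostructuredArrow.hom_ext
      apply Quiver.Hom.unop_inj
      -- Injectivity is the uniqueness of factorizations through `k`; surjectivity below is their
      -- existence.
      exact Functor.IsStronglyCocartesian.ext t Z.hom k N.hom.unop
        (ψ := negObjHom t f) (ψ' := negObjHom t g) (congrArg Subtype.val hfg)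
    · rintro ⟨α, hα⟩
      have : t.IsHomLift (Z.hom ≫ N.hom.unop) α := by
        rw [← hα]
        infer_instance
      obtain ⟨γ, ⟨hγ, hγ'⟩, -⟩ :=
        Functor.IsStronglyCocartesian.universal_property' (p := t) (f := Z.hom) (φ := k)
          N.hom.unop α
      exact ⟨CostructuredArrow.homMk γ.op
        (congrArg Quiver.Hom.op ((isHomLift_iff_eqToHom_comp t R _ _).1 hγ)), Subtype.ext hγ'⟩)

/-- If `φ` is represented by `(Z, c)` and `R` is a pushforward of `Z` along `c`, then the dual of
`φ` is represented by `(𝟙, R)`. -/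
def dualLRepresentableBy {B : T} {φ : (PosCat t B)ᵒᵖ ⥤ Type w} {Z : PosCat t B}
    (h : φ.RepresentableBy Z) (R : t.Fiber B) (k : Z.left ⟶ R.1)
    [hk : t.IsStronglyCocartesian Z.hom k] : (dualL t φ).RepresentableBy (negObj t R) where
  homEquiv {N} := (negObjHomEquiv t R k N).trans
    (residualEquiv h (der t) ((curryL (bracket t B)).obj N)).symm
  homEquiv_comp {N N'} f g := by
    -- Naturality can be tested at the universal element, where both sides become composites in `D`.
    apply (residualEquiv h (der t) ((curryL (bracket t B)).obj N)).injective
    refine ((residualEquiv h (der t) _).apply_symm_apply _).trans ?_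
    refine Eq.trans ?_ (residualEquiv_map h (der t) ((curryL (bracket t B)).map f) _).symm
    refine Eq.trans ?_ (congrArg _ ((residualEquiv h (der t) _).apply_symm_apply _).symm)
    apply Subtype.ext
    change k ≫ negObjHom t g ≫ f.left.unop = 𝟙 Z.left ≫ (k ≫ negObjHom t g) ≫ f.left.unop
    rw [Category.id_comp, Category.assoc]

/-- The dual of a presheaf over `t⁻B` represented by `(𝟙, R)` is the positive representation
of `R`. -/
lemma viso_pos_dualR {B : T} {ψ : (NegCat t B)ᵒᵖ ⥤ Type w} (R : t.Fiber B)
    (h : ψ.RepresentableBy (negObj t R)) : VIso (pos t R) (dualR t ψ) := by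
  refine VIso.of_equiv (fun x => (Equiv.subtypeEquivRight (fun α => ?_)).trans
    (residualEquiv h (der t) ((curryR (bracket t B)).obj x)).symm) ?_
  · change t.IsHomLift x.hom α ↔ t.map α = x.hom ≫ eqToHom R.2.symm
    rw [isHomLift_iff_comp_eqToHom, ← comp_eqToHom_iff]
  · intro x x' f α
    apply (residualEquiv h (der t) ((curryR (bracket t B)).obj x)).injective
    refine ((residualEquiv h (der t) _).apply_symm_apply _).trans ?_
    refine Eq.trans ?_ (residualEquiv_map h (der t) ((curryR (bracket t B)).map f) _).symm
    refine Eq.trans ?_ (congrArg _ ((residualEquiv h (der t) _).apply_symm_apply _).symm)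
    apply Subtype.ext
    change f.left ≫ α.1 = f.left ≫ α.1 ≫ 𝟙 R.1
    simp

end Basic

/-! ### The Day tensor product of positive representations -/

section Monoidal

open Functor.LaxMonoidal Functor.OplaxMonoidal

variable {D : Type u₁} [Category.{v₁} D] {T : Type u₂} [Category.{v₂} T]
  [MonoidalCategory D] [MonoidalCategory T] (t : D ⥤ T) [StrictMonoidal t]

lemma tensorHom_eqToHom {X X' Y Y' : T} (h : X = X') (k : Y = Y') :
    eqToHom h ⊗ₘ eqToHom k = eqToHom (by rw [h, k]) := by
  subst h k
  simp

lemma StrictMonoidal.δ_eq (P Q : D) : δ t P Q = eqToHom (obj_tensor (t := t) P Q).symm := by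
  -- `δ` is inverse to `μ`, which strictness makes an `eqToHom`.
  rw [← cancel_epi (μ t P Q), Functor.Monoidal.μ_δ, StrictMonoidal.μ_eq]
  simp

/-- The Day tensor product of the positive representations of `P` and `Q` is represented by
`P ⊗ Q` together with the multiplication of `W`. -/
def dayTensorRepresentableBy (W : T) [MonObj W] (P Q : t.Fiber W) :
    (dayTensor t W (pos t P) (pos t Q)).RepresentableBy
      ((str t W W ⋙ posMap t (MonObj.mul (X := W))).obj (posObj t P, posObj t Q)) :=
  pushRepresentableBy _ (extTensorRepresentableBy (posRepresentableBy t P) (posRepresentableBy t Q))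

/-- Strictness makes every factor of this structure map an `eqToHom`, so the object representing the
Day tensor product has structure map `p` up to transport along `t (P ⊗ Q) = W ⊗ W`. -/
lemma str_posObj_hom {A B : T} (P : t.Fiber A) (Q : t.Fiber B) :
    ((str t A B).obj (posObj t P, posObj t Q)).hom = eqToHom (tensorRef t P Q).2 := by
  change δ t P.1 Q.1 ≫ (eqToHom P.2 ⊗ₘ eqToHom Q.2) = _
  rw [StrictMonoidal.δ_eq, tensorHom_eqToHom, eqToHom_trans]
  rfl

end Monoidal

end

end RefinementSystem

open RefinementSystem in
theorem mainTheorem5 {D : Type u₁} [Category.{v₁} D] {T : Type u₂}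
    [Category.{v₂} T] [MonoidalCategory D] [MonoidalCategory T] (t : D ⥤ T)
    [RefinementSystem.StrictMonoidal t] (W : T) [MonObj W] (P Q : t.Fiber W)
    (PQ : RefinementSystem.FiberTensor t W P Q) :
    RefinementSystem.VIso (RefinementSystem.pos t PQ.obj)
      (RefinementSystem.dualR t (RefinementSystem.dualL t
        (RefinementSystem.dayTensor t W (RefinementSystem.pos t P)
          (RefinementSystem.pos t Q)))) := by
  have := PQ.universal
  -- The pushforward is taken along `p` itself, while the representing object carries `p` preceded
  -- by an `eqToHom`.
  have hk : t.IsStronglyCocartesian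
      ((str t W W ⋙ posMap t (MonObj.mul (X := W))).obj (posObj t P, posObj t Q)).hom PQ.hom := by
    change t.IsStronglyCocartesian
      (((str t W W).obj (posObj t P, posObj t Q)).hom ≫ MonObj.mul (X := W)) PQ.hom
    rw [str_posObj_hom]
    exact isStronglyCocartesian_eqToHom_comp t (tensorRef t P Q).2 _ PQ.hom
  exact viso_pos_dualR t PQ.obj
    (dualLRepresentableBy t (dayTensorRepresentableBy t W P Q) PQ.obj PQ.hom (hk := hk))
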